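/- Let $n\ge m\ge 1$, $p\ge 0$. Let $f_0,g_0:\mathbb R^p\to\mathbb R^p$ and $f_i,g_i:\mathbb R^p\times\mathbb R^i\to\mathbb R$ ($1\le i\le n$) be continuously differentiable. Consider the proxy subsystem $$\dot x=f_0(x)+g_0(x)\mu_1+g_0(x)e,\qquad \dot\mu_j=\mu_{j+1}\ (1\le j<m),\qquad \dot\mu_m=\nu,$$ and the scalar virtual tracking subsystem $$\dot e=f_1(x,z_1)+g_1(x,z_1)z_2-\mu_2,\qquad \dot z_i=f_i(x,z_1,\dots,z_i)+g_i(x,z_1,\dots,z_i)z_{i+1}\quad(2\le i\le n),$$ where $z_1=e+\mu_1$, $z_{n+1}=u$ is the control input and $\mu_2$ is read as $\nu$ when $m=1$, with initial values $x(0)=x_0$, $z_i(0)=z_{0,i}$ for $1\le i\le n$, $\mu_1(0)=z_1(0)$, $\mu_j(0)=0$ for $j\ge 2$. Suppose that each $g_i$ ($1\le i\le n$) has a constant known sign $s_i\in\{-1,1\}$ and that $|g_i|\ge b_i$ everywhere for some (unknown) constant $b_i>0$. Let $\rho:[0,\infty)\to(0,\infty)$ be of class $C^n$, bounded together with its derivatives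 up to order $n$; for $2\le i\le n$ let $\rho_i:[0,\infty)\to(0,\infty)$ be of class $C^1$ such that $\lim_{t\to\infty}\rho_i(t)$ exists and is positive; put $\rho_1=\rho$, and let $k_1,\dots,k_n>0$. Define recursively $\eta_0=\mu_1$ and, for $1\le i\le n$, $$\xi_i=\frac{z_i-\eta_{i-1}}{\rho_i(t)},\qquad \eta_i=-s_ik_i\log\Big(\frac{1+\xi_i}{1-\xi_i}\Big),$$ assume $|z_i(0)-\eta_{i-1}(0)|<\rho_i(0)$ for $2\le i\le n$, and apply the control law $u=\eta_n$, which uses no information on $f_i$ and $g_i$ other than the signs $s_i$. (1) For every signal $\nu$ and every solution of the closed loop on an interval $[0,T)$, $0<T\le\infty$, along which $\mu_1$ and $\mu_2$ (or $\mu_1$ and $\nu$ when $m=1$) are bounded, one has $|\xi_i(t)|<1$ for all $1\le i\le n$, so that the control law is well defined, and $|e(t)|\le\rho(t)$, for all $t\in[0,T)$. (2) If $\nu=\nu(t,x,\mu_1,\dots,\mu_m)$ is given by a continuous feedback that is locally Lipschitz in $(x,\mu_1,\dots,\mu_m)$, locally uniformly in $t$, then the closed loop has a maximal solution. Moreover,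 if $[0,T)$ is the interval of a maximal solution along which $\mu_1$ and $\mu_2$ (or $\mu_1$ and $\nu$ when $m=1$) are bounded, and $T<\infty$, then $(x,\mu_1,\dots,\mu_m)$ is unbounded on $[0,T)$. Hence if $(x,\mu_1,\dots,\mu_m)$ does not escape in finite time, then $T=\infty$ and $|e(t)|\le\rho(t)$ for all $t\ge0$. -/

import Mathlib

open Set Filter Topology

noncomputable section

namespace VirtualTracking

/-- The state space `ℝᵖ` of the `x`-dynamics. -/
abbrev XSpace (p : ℕ) : Type := EuclideanSpace ℝ (Fin p)

/-- The data of a strict-feedback system with scalar `z₁, …, zₙ`: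
`x' = f₀(x) + g₀(x) z₁`, `zᵢ' = fᵢ(x, z₁, …, zᵢ) + gᵢ(x, z₁, …, zᵢ) zᵢ₊₁`, `zₙ₊₁ = u`.
The index `i : Fin n` stands for the number `i + 1`. -/
structure StrictFeedback (p n : ℕ) where
  f₀ : XSpace p → XSpace p
  g₀ : XSpace p → XSpace p
  f : (i : Fin n) → XSpace p → (Fin (i + 1) → ℝ) → ℝ
  g : (i : Fin n) → XSpace p → (Fin (i + 1) → ℝ) → ℝ

/-- The data of the control law: the signs `s` of the control coefficients, the gains `k` and
the performance functions `ρ`, where `ρ 0` is the bound prescribed for the tracking error. -/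
structure Law (n : ℕ) where
  s : Fin n → SignType
  k : Fin n → ℝ
  ρ : Fin n → ℝ → ℝ

/-- The intermediate control signals: `eta 0 = μ₁` and `eta i` is `ηᵢ` for `i = 1, …, n`, with
`ηᵢ = -sᵢ kᵢ log ((1 + ξᵢ) / (1 - ξᵢ))` and `ξᵢ = (zᵢ - ηᵢ₋₁) / ρᵢ`. -/
def Law.eta {n : ℕ} (L : Law n) (t μ₁ : ℝ) (z : Fin n → ℝ) : Fin (n + 1) → ℝ :=
  Fin.induction (motive := fun _ => ℝ) μ₁ fun i prev =>
    -((L.s i : ℝ) * L.k i *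
      Real.log ((1 + (z i - prev) / L.ρ i t) / (1 - (z i - prev) / L.ρ i t)))

/-- The normalized errors: `ξ₁ = (z₁ - μ₁) / ρ` and `ξᵢ = (zᵢ - ηᵢ₋₁) / ρᵢ` for `i ≥ 2`. -/
def Law.xi {n : ℕ} (L : Law n) (t μ₁ : ℝ) (z : Fin n → ℝ) (i : Fin n) : ℝ :=
  (z i - L.eta t μ₁ z i.castSucc) / L.ρ i t

/-- The control input `u = ηₙ`. -/
def Law.input {n : ℕ} (L : Law n) (t μ₁ : ℝ) (z : Fin n → ℝ) : ℝ :=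
  L.eta t μ₁ z (Fin.last n)

theorem Law.eta_zero {n : ℕ} (L : Law n) (t μ₁ : ℝ) (z : Fin n → ℝ) :
    L.eta t μ₁ z 0 = μ₁ := rfl

theorem Law.eta_succ {n : ℕ} (L : Law n) (t μ₁ : ℝ) (z : Fin n → ℝ) (i : Fin n) :
    L.eta t μ₁ z i.succ =
      -((L.s i : ℝ) * L.k i * Real.log ((1 + L.xi t μ₁ z i) / (1 - L.xi t μ₁ z i))) := by
  simp only [Law.xi, Law.eta, Fin.induction_succ]

/-- The vector `(z₁, z₂, …, zₙ)` with `z₁ = e + μ₁`, where `w = (e, z₂, …, zₙ)`. -/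
def fullState {n : ℕ} [NeZero n] (μ₁ : ℝ) (w : Fin n → ℝ) : Fin n → ℝ :=
  Function.update w 0 (w 0 + μ₁)

/-- The initial part `(z₁, …, zᵢ)` of `(z₁, …, zₙ)`. -/
def initialPart {n : ℕ} (z : Fin n → ℝ) (i : Fin n) : Fin (i + 1) → ℝ :=
  fun j => z (Fin.castLE i.isLt j)

/-- `following v a i` is the entry after the `i`-th one in the list `(v₁, …, vₙ, a)`: for
`(z₁, …, zₙ, u)` this is `zᵢ₊₁` (and `u` for `i = n`), for `(μ₁, …, μₘ, ν)` it is `μⱼ₊₁`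
(and `ν` for `j = m`). -/
def following {n : ℕ} (v : Fin n → ℝ) (a : ℝ) (i : Fin n) : ℝ :=
  (Fin.snoc v a : Fin (n + 1) → ℝ) i.succ

/-- The time interval `[0, T)`, `T ≤ ∞`. -/
def timeDomain (T : EReal) : Set ℝ := {t | 0 ≤ t ∧ (t : EReal) < T}

/-- `(x, μ, w)`, with `w = (e, z₂, …, zₙ)`, solves on `[0, T)` the proxy subsystem with virtual
input signal `ν`, together with the virtual tracking subsystem under the control `u = ηₙ`,
with initial values `x(0) = x₀`, `z(0) = z₀`, `μ₁(0) = z₁(0)`, `μⱼ(0) = 0` for `j ≥ 2`.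
It is not required here that the normalized errors stay in `(-1, 1)`. -/
structure IsSolution {p n m : ℕ} [NeZero n] [NeZero m] (S : StrictFeedback p n) (L : Law n)
    (x₀ : XSpace p) (z₀ : Fin n → ℝ) (ν : ℝ → ℝ) (T : EReal)
    (x : ℝ → XSpace p) (μ : ℝ → Fin m → ℝ) (w : ℝ → Fin n → ℝ) : Prop where
  pos : 0 < T
  init_x : x 0 = x₀
  init_μ : μ 0 = Pi.single 0 (z₀ 0)
  init_z : fullState (μ 0 0) (w 0) = z₀
  deriv_x : ∀ t ∈ timeDomain T,
    HasDerivWithinAt x (S.f₀ (x t) + μ t 0 • S.g₀ (x t) + w t 0 • S.g₀ (x t)) (timeDomain T) t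
  deriv_μ : ∀ t ∈ timeDomain T, ∀ j : Fin m,
    HasDerivWithinAt (fun τ => μ τ j) (following (μ t) (ν t) j) (timeDomain T) t
  deriv_w : ∀ t ∈ timeDomain T, ∀ i : Fin n,
    HasDerivWithinAt (fun τ => w τ i)
      (S.f i (x t) (initialPart (fullState (μ t 0) (w t)) i)
        + S.g i (x t) (initialPart (fullState (μ t 0) (w t)) i)
          * following (fullState (μ t 0) (w t))
              (L.input t (μ t 0) (fullState (μ t 0) (w t))) i
        - if i = 0 then following (μ t) (ν t) 0 else 0) (timeDomain T) t

/-- Hypothesis on the virtual states along `[0, T)`: `μ₁` and `μ₁'` are bounded, where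
`μ₁' = μ₂` if `m > 1` and `μ₁' = ν` if `m = 1`. -/
def ReferenceBounded {m : ℕ} [NeZero m] (ν : ℝ → ℝ) (T : EReal) (μ : ℝ → Fin m → ℝ) : Prop :=
  ∃ B : ℝ, ∀ t ∈ timeDomain T, |μ t 0| ≤ B ∧ |following (μ t) (ν t) 0| ≤ B

/-- A virtual controller `ν(t, x, μ)` for `t ≥ 0` that is continuous, and locally Lipschitz in
`(x, μ)`, locally uniformly in `t`. -/
structure IsRegularFeedback {p m : ℕ} (N : ℝ → XSpace p × (Fin m → ℝ) → ℝ) : Prop where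
  continuousOn : ContinuousOn (Function.uncurry N) (Ici 0 ×ˢ univ)
  lipschitz : ∀ t₀ : ℝ, 0 ≤ t₀ → ∀ y₀ : XSpace p × (Fin m → ℝ),
    ∃ K : NNReal, ∃ V ∈ 𝓝[Ici 0] t₀, ∃ U ∈ 𝓝 y₀, ∀ t ∈ V, LipschitzOnWith K (N t) U

/-- A solution on `[0, T)`, with `ν` generated by the feedback `N`, that has no extension to a
longer interval. -/
def IsMaximalSolution {p n m : ℕ} [NeZero n] [NeZero m] (S : StrictFeedback p n) (L : Law n)
    (x₀ : XSpace p) (z₀ : Fin n → ℝ) (N : ℝ → XSpace p × (Fin m → ℝ) → ℝ) (T : EReal)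
    (x : ℝ → XSpace p) (μ : ℝ → Fin m → ℝ) (w : ℝ → Fin n → ℝ) : Prop :=
  IsSolution S L x₀ z₀ (fun t => N t (x t, μ t)) T x μ w ∧
  ∀ (T' : EReal) (x' : ℝ → XSpace p) (μ' : ℝ → Fin m → ℝ) (w' : ℝ → Fin n → ℝ),
    IsSolution S L x₀ z₀ (fun t => N t (x' t, μ' t)) T' x' μ' w' →
    EqOn x' x (timeDomain T) → EqOn μ' μ (timeDomain T) → EqOn w' w (timeDomain T) →
    T' ≤ T

end VirtualTracking

end

/-!
The closed loop is treated as a first-order system in the state `(x, μ, w)`, `w = (e, z₂, …, zₙ)`.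
In the variables `z₁ = e + μ₁, z₂, …, zₙ` the tracking subsystem is a plain strict-feedback
cascade `zᵢ' = fᵢ + gᵢ zᵢ₊₁`, and `zᵢ₊₁ = ηᵢ + ρᵢ₊₁ ξᵢ₊₁` acts on the `i`-th equation as the
feedback `ηᵢ` plus a disturbance that is bounded as long as `|ξᵢ₊₁| < 1`.

On a bounded time interval `[0, τ)` on which all `|ξᵢ| < 1` and `x`, `μ₁`, `μ₁'` are bounded, go
down the cascade (`SolvesOn.boundedOn_cascade`). If `ηᵢ₋₁` and its derivative are bounded, so is
`zᵢ`, hence so are `fᵢ` and `gᵢ`. Since `gᵢ` has the sign `sᵢ` and is bounded away from `0`, the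
feedback `-sᵢ kᵢ log ((1 + ξᵢ) / (1 - ξᵢ))` dominates all bounded terms when `ξᵢ` is close to
`±1`, and drives `ξᵢ` back (`boundedOn_feedback`, `exists_upper_barrier`). So `|ξᵢ| ≤ c < 1`,
which makes `ηᵢ` and its derivative bounded.

The region `|ξᵢ| < 1` is therefore invariant (`SolvesOn.abs_xi_lt_one`): at a first exit time the
solution is continuous, hence bounded, and the uniform bound passes to the limit. This is the
first assertion, as `ξ₁ = e / ρ`.

In this region the vector field is continuous and locally Lipschitz in the state
(`StrictFeedback.regularAt_closedLoop`), which gives local existence by the Picard–Lindelöf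
theorem, and a maximal solution by Zorn's lemma (`exists_maximal_solution`). If `x` and `μ` were
bounded along a maximal solution on `[0, τ)`, `τ < ∞`, then by the cascade the state would have a
bounded derivative, hence a limit in the region, from which it could be continued
(`SolvesOn.exists_extension_of_boundedOn`).
-/

namespace VirtualTracking

/-! ### Initial value problems on half-open intervals -/

theorem timeDomain_coe (τ : ℝ) : timeDomain (τ : EReal) = Ico 0 τ := by
  ext t
  simp [timeDomain]

theorem zero_mem_timeDomain {T : EReal} (hT : 0 < T) : (0 : ℝ) ∈ timeDomain T :=
  ⟨le_rfl, by simpa using hT⟩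

theorem timeDomain_mono {T T' : EReal} (h : T ≤ T') : timeDomain T ⊆ timeDomain T' :=
  fun _ ht => ⟨ht.1, ht.2.trans_le h⟩

theorem timeDomain_mem_nhdsWithin_Ici {T : EReal} {t : ℝ} (ht : t ∈ timeDomain T) :
    timeDomain T ∈ 𝓝[Ici 0] t := by
  have : {s : ℝ | (s : EReal) < T} ∈ 𝓝 t :=
    (isOpen_Iio.preimage continuous_coe_real_ereal).mem_nhds ht.2
  exact inter_mem_nhdsWithin _ this

theorem timeDomain_mem_nhdsWithin {T T' : EReal} {t : ℝ} (ht : t ∈ timeDomain T) :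
    timeDomain T ∈ 𝓝[timeDomain T'] t :=
  nhdsWithin_mono _ (fun _ h => h.1) (timeDomain_mem_nhdsWithin_Ici ht)

section
variable {Y : Type*} [NormedAddCommGroup Y]

/-- Near `(t₀, y₀)` and for nonnegative times, `F` is continuous, and Lipschitz in the state with a
constant that does not depend on the time. -/
def RegularAt (F : ℝ → Y → Y) (t₀ : ℝ) (y₀ : Y) : Prop :=
  ∃ K : NNReal, ∃ V ∈ 𝓝[Ici 0] t₀, ∃ U ∈ 𝓝 y₀,
    (∀ t ∈ V, LipschitzOnWith K (F t) U) ∧ ContinuousOn (Function.uncurry F) (V ×ˢ U)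

theorem RegularAt.continuousWithinAt {F : ℝ → Y → Y} {t₀ : ℝ} {y₀ : Y} (h : RegularAt F t₀ y₀)
    (ht₀ : 0 ≤ t₀) : ContinuousWithinAt (Function.uncurry F) (Ici 0 ×ˢ univ) (t₀, y₀) := by
  obtain ⟨K, V, hV, U, hU, -, hc⟩ := h
  refine (hc (t₀, y₀) ⟨mem_of_mem_nhdsWithin ht₀ hV, mem_of_mem_nhds hU⟩).mono_of_mem_nhdsWithin ?_
  rw [nhdsWithin_prod_eq, nhdsWithin_univ]
  exact prod_mem_prod hV hU

variable [NormedSpace ℝ Y]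

/-- `y` solves `y' = F(t, y)` on the set `D` of times. -/
def SolvesOn (F : ℝ → Y → Y) (D : Set ℝ) (y : ℝ → Y) : Prop :=
  ∀ t ∈ D, HasDerivWithinAt y (F t (y t)) D t

/-- Local existence, forward in time. -/
theorem RegularAt.exists_solvesOn [CompleteSpace Y] {F : ℝ → Y → Y} {t₀ : ℝ} {y₀ : Y}
    (h : RegularAt F t₀ y₀) (ht₀ : 0 ≤ t₀) :
    ∃ ε > 0, ∃ y : ℝ → Y, y t₀ = y₀ ∧ SolvesOn F (Icc t₀ (t₀ + ε)) y := by
  obtain ⟨K, V, hV, U, hU, hlip, hc⟩ := h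
  have hmem : t₀ ∈ V := mem_of_mem_nhdsWithin ht₀ hV
  have hmem' : y₀ ∈ U := mem_of_mem_nhds hU
  have hcy : ∀ y ∈ U, ContinuousOn (fun t => F t y) V := fun y hy =>
    hc.comp (f := fun t : ℝ => (t, y)) (by fun_prop) fun t ht => ⟨ht, hy⟩
  obtain ⟨a, ha, haU⟩ := Metric.nhds_basis_closedBall.mem_iff.1 hU
  have hbd : ∀ᶠ t in 𝓝[V] t₀, ‖F t y₀‖ < ‖F t₀ y₀‖ + 1 :=
    ((hcy y₀ hmem' t₀ hmem).norm).eventually_lt_const (by linarith)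
  have hbd' : ∀ᶠ t in 𝓝[Ici 0] t₀, t ∈ V ∧ ‖F t y₀‖ < ‖F t₀ y₀‖ + 1 := by
    filter_upwards [hV, nhdsWithin_le_iff.2 hV hbd] with t h1 h2 using ⟨h1, h2⟩
  rw [Filter.Eventually, Metric.mem_nhdsWithin_iff] at hbd'
  obtain ⟨δ, hδ, hball⟩ := hbd'
  set M : ℝ := ‖F t₀ y₀‖ + 1 + K * a with hM
  have hMpos : 0 < M := by positivity
  set ε : ℝ := min (δ / 2) (a / M) with hε
  have hεpos : 0 < ε := by positivity
  have hsub : ∀ t ∈ Icc t₀ (t₀ + ε), t ∈ V ∧ ‖F t y₀‖ < ‖F t₀ y₀‖ + 1 := fun t ht => by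
    refine hball ⟨?_, ht₀.trans ht.1⟩
    have : ε ≤ δ / 2 := min_le_left _ _
    rw [Metric.mem_ball, Real.dist_eq, abs_of_nonneg (by linarith [ht.1])]
    linarith [ht.2]
  have hPL : IsPicardLindelof F (tmin := t₀) (tmax := t₀ + ε) ⟨t₀, le_rfl, by linarith⟩ y₀
      ⟨a, ha.le⟩ 0 ⟨M, hMpos.le⟩ K :=
    { lipschitzOnWith := fun t ht => (hlip t (hsub t ht).1).mono haU
      continuousOn := fun y hy => (hcy y (haU hy)).mono fun t ht => (hsub t ht).1
      norm_le := fun t ht y hy => by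
        have h1 := (hlip t (hsub t ht).1).norm_sub_le (haU hy) hmem'
        have h2 : ‖y - y₀‖ ≤ a := mem_closedBall_iff_norm.1 hy
        have h3 : ‖F t y‖ ≤ ‖F t y - F t y₀‖ + ‖F t y₀‖ := by
          simpa using norm_add_le (F t y - F t y₀) (F t y₀)
        have h4 : (K : ℝ) * ‖y - y₀‖ ≤ K * a := by gcongr
        change ‖F t y‖ ≤ M
        linarith [(hsub t ht).2]
      mul_max_le := by
        have : ε ≤ a / M := min_le_right _ _
        have h2 : M * ε ≤ a := by rwa [le_div_iff₀' hMpos] at this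
        change M * max (t₀ + ε - t₀) (t₀ - t₀) ≤ a - 0
        simpa [hεpos.le] using h2 }
  obtain ⟨y, hy, hy'⟩ := hPL.exists_eq_forall_mem_Icc_hasDerivWithinAt₀
  exact ⟨ε, hεpos, y, hy, hy'⟩

/-- A function with bounded derivative on a bounded half-open interval has a limit at the open
end. -/
theorem exists_tendsto_of_bounded_deriv [CompleteSpace Y] {y y' : ℝ → Y} {τ C : ℝ} (hτ : 0 < τ)
    (hy : ∀ t ∈ Ico 0 τ, HasDerivWithinAt y (y' t) (Ico 0 τ) t)
    (hC : ∀ t ∈ Ico 0 τ, ‖y' t‖ ≤ C) : ∃ l, Tendsto y (𝓝[<] τ) (𝓝 l) := by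
  have hlip : LipschitzOnWith C.toNNReal y (Ico 0 τ) :=
    (convex_Ico 0 τ).lipschitzOnWith_of_nnnorm_hasDerivWithin_le hy fun t ht => by
      rw [← NNReal.coe_le_coe, coe_nnnorm]
      exact (hC t ht).trans (Real.le_coe_toNNReal C)
  have hcauchy : Cauchy (map y (𝓝[<] τ)) :=
    (cauchy_nhds.mono nhdsWithin_le_nhds).map_of_le hlip.uniformContinuousOn
      (le_principal_iff.2 (Ico_mem_nhdsLT hτ))
  exact CompleteSpace.complete hcauchy

/-- A solution on `[0, τ)` that converges at `τ` to a point where the vector field is regular can be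
continued beyond `τ`. -/
theorem SolvesOn.exists_extension [CompleteSpace Y] {F : ℝ → Y → Y} {τ : ℝ} (hτ : 0 < τ)
    {y : ℝ → Y} {l : Y} (hy : SolvesOn F (Ico 0 τ) y) (hl : Tendsto y (𝓝[<] τ) (𝓝 l))
    (hreg : RegularAt F τ l) :
    ∃ ε > 0, ∃ y' : ℝ → Y, EqOn y' y (Ico 0 τ) ∧ SolvesOn F (Ico 0 (τ + ε)) y' := by
  obtain ⟨ε, hε, v, hv0, hv⟩ := hreg.exists_solvesOn hτ.le
  set Z : ℝ → Y := fun t => if t < τ then y t else v t with hZ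
  have hZy : ∀ t, t < τ → Z t = y t := fun t ht => if_pos ht
  have hZv : ∀ t, τ ≤ t → Z t = v t := fun t ht => if_neg ht.not_gt
  refine ⟨ε, hε, Z, fun t ht => hZy t ht.2, fun t ht => ?_⟩
  rcases lt_trichotomy t τ with h | rfl | h
  · have hmem : Ico 0 τ ∈ 𝓝[Ico 0 (τ + ε)] t := by
      have : Iio τ ∈ 𝓝[Ico 0 (τ + ε)] t := mem_nhdsWithin_of_mem_nhds (Iio_mem_nhds h)
      filter_upwards [this, self_mem_nhdsWithin] with s h1 h2 using ⟨h2.1, h1⟩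
    have := (hy t ⟨ht.1, h⟩).mono_of_mem_nhdsWithin hmem
    rw [hZy t h]
    refine this.congr_of_eventuallyEq ?_ (hZy t h)
    filter_upwards [hmem] with s hs using hZy s hs.2
  · -- at the junction the left derivative comes from the limit of the derivative
    have hleft : HasDerivWithinAt Z (F t l) (Iic t) t := by
      have hder : ∀ s ∈ Ioo 0 t, HasDerivAt Z (F s (y s)) s := fun s hs => by
        have h1 : HasDerivAt y (F s (y s)) s :=
          (hy s ⟨hs.1.le, hs.2⟩).hasDerivAt (Ico_mem_nhds hs.1 hs.2)
        refine h1.congr_of_eventuallyEq ?_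
        filter_upwards [Iio_mem_nhds hs.2] with r hr using hZy r hr
      refine hasDerivWithinAt_Iic_of_tendsto_deriv (s := Ioo 0 t)
        (fun s hs => (hder s hs).differentiableAt.differentiableWithinAt) ?_
        (Ioo_mem_nhdsLT hτ) ?_
      · have : Tendsto Z (𝓝[Ioo 0 t] t) (𝓝 (Z t)) := by
          rw [hZv t le_rfl, hv0]
          refine (hl.mono_left (nhdsWithin_mono _ Ioo_subset_Iio_self)).congr' ?_
          filter_upwards [self_mem_nhdsWithin] with s hs using (hZy s hs.2).symm
        exact this
      · have h1 : Tendsto (fun s => (s, y s)) (𝓝[<] t) (𝓝[Ici 0 ×ˢ univ] (t, l)) := by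
          refine tendsto_nhdsWithin_iff.2 ⟨?_, ?_⟩
          · exact (tendsto_id.mono_left nhdsWithin_le_nhds).prodMk_nhds hl
          · filter_upwards [Ioo_mem_nhdsLT hτ] with s hs using ⟨hs.1.le, trivial⟩
        refine ((hreg.continuousWithinAt hτ.le).tendsto.comp h1).congr' ?_
        filter_upwards [Ioo_mem_nhdsLT hτ] with s hs using (hder s hs).deriv.symm
    have hright : HasDerivWithinAt Z (F t l) (Icc t (t + ε)) t := by
      have := hv t ⟨le_rfl, by linarith⟩
      rw [hv0] at this
      exact this.congr (fun s hs => hZv s hs.1) (hZv t le_rfl)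
    rw [hZv t le_rfl, hv0]
    refine (hleft.union hright).mono fun s hs => ?_
    rcases le_total s t with h | h
    · exact Or.inl h
    · exact Or.inr ⟨h, hs.2.le⟩
  · have hmem : Icc τ (τ + ε) ∈ 𝓝[Ico 0 (τ + ε)] t := by
      have : Ioi τ ∈ 𝓝[Ico 0 (τ + ε)] t := mem_nhdsWithin_of_mem_nhds (Ioi_mem_nhds h)
      filter_upwards [this, self_mem_nhdsWithin] with s h1 h2 using ⟨le_of_lt h1, h2.2.le⟩
    have := (hv t ⟨h.le, ht.2.le⟩).mono_of_mem_nhdsWithin hmem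
    rw [hZv t h.le]
    refine this.congr_of_eventuallyEq ?_ (hZv t h.le)
    filter_upwards [hmem] with s hs using hZv s hs.1

/-- A nonempty set of solutions of an initial value problem has a maximal one. Uniqueness is not
needed: Zorn's lemma applies, since the union of a chain of solutions is a solution. -/
theorem exists_maximal_solution {F : ℝ → Y → Y} {y₀ : Y}
    (h : ∃ (T : EReal) (y : ℝ → Y), 0 < T ∧ y 0 = y₀ ∧ SolvesOn F (timeDomain T) y) :
    ∃ (T : EReal) (y : ℝ → Y), (0 < T ∧ y 0 = y₀ ∧ SolvesOn F (timeDomain T) y) ∧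
      ∀ (T' : EReal) (y' : ℝ → Y), (0 < T' ∧ y' 0 = y₀ ∧ SolvesOn F (timeDomain T') y') →
        EqOn y' y (timeDomain T) → T' ≤ T := by
  classical
  let A := {a : EReal × (ℝ → Y) // 0 < a.1 ∧ a.2 0 = y₀ ∧ SolvesOn F (timeDomain a.1) a.2}
  let r : A → A → Prop := fun a b => a.1.1 ≤ b.1.1 ∧ EqOn b.1.2 a.1.2 (timeDomain a.1.1)
  have : Nonempty A := let ⟨T, y, h⟩ := h; ⟨⟨(T, y), h⟩⟩
  obtain ⟨⟨⟨T, y⟩, hTy⟩, hmax⟩ := exists_maximal_of_nonempty_chains_bounded (r := r)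
    (fun c hc hne => by
    let T : EReal := ⨆ a : c, a.1.1.1
    let y : ℝ → Y := fun t => if ht : ∃ a ∈ c, t ∈ timeDomain a.1.1 then ht.choose.1.2 t else 0
    have hT : ∀ a ∈ c, a.1.1 ≤ T := fun a ha => le_iSup (fun a : c => a.1.1.1) ⟨a, ha⟩
    have hy : ∀ a ∈ c, EqOn y a.1.2 (timeDomain a.1.1) := fun a ha t ht => by
      have hex : ∃ a ∈ c, t ∈ timeDomain a.1.1 := ⟨a, ha, ht⟩
      have hyt : y t = hex.choose.1.2 t := dif_pos hex
      rw [hyt]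
      have hs := hex.choose_spec
      by_cases hab : hex.choose = a
      · rw [hab]
      · rcases hc hs.1 ha hab with h1 | h1
        · exact (h1.2 hs.2).symm
        · exact h1.2 ht
    have hcover : ∀ t ∈ timeDomain T, ∃ a ∈ c, t ∈ timeDomain a.1.1 := fun t ht => by
      obtain ⟨a, ha⟩ := lt_iSup_iff.1 ht.2
      exact ⟨a.1, a.2, ht.1, ha⟩
    obtain ⟨a, ha⟩ := hne
    refine ⟨⟨(T, y), a.2.1.trans_le (hT a ha), ?_, fun t ht => ?_⟩, fun b hb => ⟨hT b hb, hy b hb⟩⟩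
    · exact (hy a ha (zero_mem_timeDomain a.2.1)).trans a.2.2.1
    · obtain ⟨b, hb, htb⟩ := hcover t ht
      have h1 := (b.2.2.2 t htb).mono_of_mem_nhdsWithin (timeDomain_mem_nhdsWithin (T' := T) htb)
      change HasDerivWithinAt y (F t (y t)) (timeDomain T) t
      rw [hy b hb htb]
      refine h1.congr_of_eventuallyEq ?_ (hy b hb htb)
      filter_upwards [timeDomain_mem_nhdsWithin (T' := T) htb] with s hs using hy b hb hs)
    (fun {a b c} h1 h2 => ⟨h1.1.trans h2.1, fun t ht =>
      (h2.2 (timeDomain_mono h1.1 ht)).trans (h1.2 ht)⟩)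
  refine ⟨T, y, hTy, fun T' y' h' he => ?_⟩
  by_contra! hlt
  exact absurd (hmax ⟨(T', y'), h'⟩ ⟨hlt.le, he⟩).1 (not_le.2 hlt)

end

/-! ### The closed loop as a first-order system -/

/-- The states `(x, μ, w)` of the closed loop, where `w = (e, z₂, …, zₙ)`. -/
abbrev State (p m n : ℕ) : Type := XSpace p × (Fin m → ℝ) × (Fin n → ℝ)

/-- The vector `(z₁, …, zₙ)` of a state `(x, μ, w)`. -/
def State.z {p m n : ℕ} [NeZero n] [NeZero m] (y : State p m n) : Fin n → ℝ :=
  fullState (y.2.1 0) y.2.2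

/-- The open-loop vector field at the point `(ν, u, (x, μ, w))`: the virtual input `ν` and the
control input `u` are treated as independent variables. -/
def StrictFeedback.plant {p n m : ℕ} [NeZero n] [NeZero m] (S : StrictFeedback p n)
    (v : ℝ × ℝ × State p m n) : State p m n :=
  (S.f₀ v.2.2.1 + v.2.2.2.1 0 • S.g₀ v.2.2.1 + v.2.2.2.2 0 • S.g₀ v.2.2.1,
    fun j => following v.2.2.2.1 v.1 j,
    fun i => S.f i v.2.2.1 (initialPart v.2.2.z i)
      + S.g i v.2.2.1 (initialPart v.2.2.z i) * following v.2.2.z v.2.1 i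
      - if i = 0 then following v.2.2.2.1 v.1 0 else 0)

/-- The closed-loop vector field, with virtual input `ν = N(t, x, μ)`. -/
noncomputable def StrictFeedback.closedLoop {p n m : ℕ} [NeZero n] [NeZero m]
    (S : StrictFeedback p n) (L : Law n) (N : ℝ → XSpace p × (Fin m → ℝ) → ℝ) (t : ℝ)
    (y : State p m n) : State p m n :=
  S.plant (N t (y.1, y.2.1), L.input t (y.2.1 0) y.z, y)

/-- The initial state `(x₀, (z₁(0), 0, …, 0), (0, z₂(0), …, zₙ(0)))`. -/
def initialState {p n : ℕ} (m : ℕ) [NeZero n] [NeZero m] (x₀ : XSpace p) (z₀ : Fin n → ℝ) :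
    State p m n :=
  (x₀, Pi.single 0 (z₀ 0), Function.update z₀ 0 0)

section
variable {n : ℕ}

theorem following_of_lt {v : Fin n → ℝ} {a : ℝ} {i : Fin n} (h : (i : ℕ) + 1 < n) :
    following v a i = v ⟨i + 1, h⟩ := by
  have : i.succ = Fin.castSucc ⟨i + 1, h⟩ := by ext; simp
  rw [following, this, Fin.snoc_castSucc]

theorem following_of_eq {v : Fin n → ℝ} {a : ℝ} {i : Fin n} (h : (i : ℕ) + 1 = n) :
    following v a i = a := by
  have : i.succ = Fin.last n := by ext; simp [h]
  rw [following, this, Fin.snoc_last]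

theorem contDiff_following (i : Fin n) :
    ContDiff ℝ 1 (fun v : (Fin n → ℝ) × ℝ => following v.1 v.2 i) := by
  rcases (Nat.succ_le_of_lt i.isLt).lt_or_eq with h | h
  · simp only [following_of_lt h]
    fun_prop
  · simp only [following_of_eq h]
    fun_prop

end

section
variable {p n m : ℕ} [NeZero n] [NeZero m]

theorem initialState_z (x₀ : XSpace p) (z₀ : Fin n → ℝ) : (initialState m x₀ z₀).z = z₀ := by
  simp [initialState, State.z, fullState]

theorem fullState_single_eq_iff (z₀ w : Fin n → ℝ) :
    fullState (z₀ 0) w = z₀ ↔ w = Function.update z₀ 0 0 := by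
  constructor
  · intro h
    have h0 : w 0 = 0 := by simpa [fullState] using congrFun h 0
    funext i
    by_cases hi : i = 0
    · subst hi; simp [h0]
    · simpa [fullState, hi] using congrFun h i
  · rintro rfl
    simp [fullState]

theorem isSolution_iff {S : StrictFeedback p n} {L : Law n} {x₀ : XSpace p} {z₀ : Fin n → ℝ}
    {N : ℝ → XSpace p × (Fin m → ℝ) → ℝ} {T : EReal} {x : ℝ → XSpace p} {μ : ℝ → Fin m → ℝ}
    {w : ℝ → Fin n → ℝ} :
    IsSolution S L x₀ z₀ (fun t => N t (x t, μ t)) T x μ w ↔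
      0 < T ∧ (x 0, μ 0, w 0) = initialState m x₀ z₀ ∧
        SolvesOn (S.closedLoop L N) (timeDomain T) (fun t => (x t, μ t, w t)) := by
  constructor
  · rintro ⟨h1, h2, h3, h4, h5, h6, h7⟩
    refine ⟨h1, ?_, fun t ht => ?_⟩
    · have : w 0 = Function.update z₀ 0 0 := by
        rw [h3, Pi.single_eq_same] at h4
        exact (fullState_single_eq_iff _ _).1 h4
      simp only [initialState, h2, h3, this]
    · exact (h5 t ht).prodMk ((hasDerivWithinAt_pi.2 (h6 t ht)).prodMk
        (hasDerivWithinAt_pi.2 (h7 t ht)))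
  · rintro ⟨h1, h2, h3⟩
    simp only [initialState, Prod.mk.injEq] at h2
    refine ⟨h1, h2.1, h2.2.1, ?_, fun t ht => ?_, fun t ht => ?_, fun t ht => ?_⟩
    · rw [h2.2.1, Pi.single_eq_same]
      exact (fullState_single_eq_iff _ _).2 h2.2.2
    · exact (h3 t ht).fst
    · exact hasDerivWithinAt_pi.1 (h3 t ht).snd.fst
    · exact hasDerivWithinAt_pi.1 (h3 t ht).snd.snd

theorem State.contDiff_z : ContDiff ℝ 1 (fun y : State p m n => y.z) := by
  refine contDiff_pi.2 fun i => ?_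
  by_cases hi : i = 0
  · subst hi
    simp only [State.z, fullState, Function.update_self]
    fun_prop
  · simp only [State.z, fullState, Function.update_of_ne hi]
    fun_prop

theorem StrictFeedback.contDiff_plant {S : StrictFeedback p n}
    (hf₀ : ContDiff ℝ 1 S.f₀) (hg₀ : ContDiff ℝ 1 S.g₀)
    (hf : ∀ i, ContDiff ℝ 1 (Function.uncurry (S.f i)))
    (hg : ∀ i, ContDiff ℝ 1 (Function.uncurry (S.g i))) :
    ContDiff ℝ 1 (S.plant (m := m)) := by
  have hz : ContDiff ℝ 1 (fun v : ℝ × ℝ × State p m n => v.2.2.z) :=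
    State.contDiff_z.comp (by fun_prop)
  have hpart : ∀ i : Fin n, ContDiff ℝ 1 (fun v : ℝ × ℝ × State p m n =>
      (v.2.2.1, initialPart v.2.2.z i)) := fun i => by
    refine ContDiff.prodMk (by fun_prop) (contDiff_pi.2 fun j => ?_)
    exact (contDiff_pi.1 hz _)
  have hx : ContDiff ℝ 1 (fun v : ℝ × ℝ × State p m n => v.2.2.1) := by fun_prop
  have hμ : ∀ j, ContDiff ℝ 1 (fun v : ℝ × ℝ × State p m n => following v.2.2.2.1 v.1 j) :=
    fun j => (contDiff_following j).comp (f := fun v : ℝ × ℝ × State p m n => (v.2.2.2.1, v.1))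
      (by fun_prop)
  have hfz : ∀ i, ContDiff ℝ 1 (fun v : ℝ × ℝ × State p m n =>
      S.f i v.2.2.1 (initialPart v.2.2.z i)) := fun i => (hf i).comp (hpart i)
  have hgz : ∀ i, ContDiff ℝ 1 (fun v : ℝ × ℝ × State p m n =>
      S.g i v.2.2.1 (initialPart v.2.2.z i)) := fun i => (hg i).comp (hpart i)
  have hnext : ∀ i, ContDiff ℝ 1 (fun v : ℝ × ℝ × State p m n => following v.2.2.z v.2.1 i) :=
    fun i => (contDiff_following i).comp (f := fun v : ℝ × ℝ × State p m n => (v.2.2.z, v.2.1))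
      (hz.prodMk (by fun_prop))
  have hf₀x : ContDiff ℝ 1 (fun v : ℝ × ℝ × State p m n => S.f₀ v.2.2.1) := hf₀.comp hx
  have hg₀x : ContDiff ℝ 1 (fun v : ℝ × ℝ × State p m n => S.g₀ v.2.2.1) := hg₀.comp hx
  refine ContDiff.prodMk ?_ (ContDiff.prodMk (contDiff_pi.2 hμ) (contDiff_pi.2 fun i => ?_))
  · fun_prop
  · refine ((hfz i).add ((hgz i).mul (hnext i))).sub ?_
    split_ifs
    · exact hμ 0
    · exact contDiff_const

end

/-! ### Regularity of the control law -/

/-- The law whose performance functions are the constants `r i`. The value of `eta` at time `t`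
depends on `t` only through `r i = ρ i t`, and it is smooth in `r`. -/
def Law.freeze {n : ℕ} (L : Law n) (r : Fin n → ℝ) : Law n := { L with ρ := fun i _ => r i }

section
variable {n : ℕ}

theorem Law.contDiffAt_eta (L : Law n) {r₀ : Fin n → ℝ} {a₀ : ℝ} {z₀ : Fin n → ℝ}
    (hr : ∀ j, 0 < r₀ j) (i : Fin (n + 1))
    (hξ : ∀ j : Fin n, j.castSucc < i → |(L.freeze r₀).xi 0 a₀ z₀ j| < 1) :
    ContDiffAt ℝ 1 (fun v : (Fin n → ℝ) × ℝ × (Fin n → ℝ) => (L.freeze v.1).eta 0 v.2.1 v.2.2 i)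
      (r₀, a₀, z₀) := by
  induction i using Fin.induction with
  | zero =>
    simp only [Law.eta_zero]
    fun_prop
  | succ i ih =>
    have h1 := abs_lt.1 (hξ i i.castSucc_lt_succ)
    have hprev := ih fun j hj => hξ j (hj.trans i.castSucc_lt_succ)
    have hxi : ContDiffAt ℝ 1 (fun v : (Fin n → ℝ) × ℝ × (Fin n → ℝ) =>
        (L.freeze v.1).xi 0 v.2.1 v.2.2 i) (r₀, a₀, z₀) :=
      ContDiffAt.div (ContDiffAt.sub (by fun_prop) hprev)
        (show ContDiffAt ℝ 1 (fun v : (Fin n → ℝ) × ℝ × (Fin n → ℝ) => v.1 i) _ by fun_prop)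
        (hr i).ne'
    have hquot : ContDiffAt ℝ 1 (fun v : (Fin n → ℝ) × ℝ × (Fin n → ℝ) =>
        (1 + (L.freeze v.1).xi 0 v.2.1 v.2.2 i) / (1 - (L.freeze v.1).xi 0 v.2.1 v.2.2 i))
        (r₀, a₀, z₀) :=
      ContDiffAt.div (contDiffAt_const.add hxi) (contDiffAt_const.sub hxi)
        (by dsimp only; linarith [h1.2])
    simp only [Law.eta_succ]
    change ContDiffAt ℝ 1 (fun v : (Fin n → ℝ) × ℝ × (Fin n → ℝ) => -((L.s i : ℝ) * L.k i *
      Real.log ((1 + (L.freeze v.1).xi 0 v.2.1 v.2.2 i) / (1 - (L.freeze v.1).xi 0 v.2.1 v.2.2 i))))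
      (r₀, a₀, z₀)
    refine (contDiffAt_const.mul (hquot.log ?_)).neg
    exact (div_pos (by linarith) (by linarith)).ne'

variable {L : Law n} {α : Type*} {l : Filter α} {s μ₁ : α → ℝ} {z : α → Fin n → ℝ}
  {t₀ a₀ : ℝ} {z₀ : Fin n → ℝ}

theorem Law.tendsto_eta (hpos : ∀ i, 0 < L.ρ i t₀)
    (hρ : ∀ i, Tendsto (fun a => L.ρ i (s a)) l (𝓝 (L.ρ i t₀))) (hμ : Tendsto μ₁ l (𝓝 a₀))
    (hz : Tendsto z l (𝓝 z₀)) (i : Fin (n + 1))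
    (hξ : ∀ j : Fin n, j.castSucc < i → |L.xi t₀ a₀ z₀ j| < 1) :
    Tendsto (fun a => L.eta (s a) (μ₁ a) (z a) i) l (𝓝 (L.eta t₀ a₀ z₀ i)) :=
  (L.contDiffAt_eta (r₀ := fun i => L.ρ i t₀) hpos i hξ).continuousAt.tendsto.comp
    ((tendsto_pi_nhds.2 hρ).prodMk_nhds (hμ.prodMk_nhds hz))

theorem Law.tendsto_xi (hpos : ∀ i, 0 < L.ρ i t₀)
    (hρ : ∀ i, Tendsto (fun a => L.ρ i (s a)) l (𝓝 (L.ρ i t₀))) (hμ : Tendsto μ₁ l (𝓝 a₀))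
    (hz : Tendsto z l (𝓝 z₀)) (i : Fin n)
    (hξ : ∀ j : Fin n, j < i → |L.xi t₀ a₀ z₀ j| < 1) :
    Tendsto (fun a => L.xi (s a) (μ₁ a) (z a) i) l (𝓝 (L.xi t₀ a₀ z₀ i)) :=
  ((tendsto_pi_nhds.1 hz i).sub (Law.tendsto_eta hpos hρ hμ hz i.castSucc
    fun j hj => hξ j (Fin.castSucc_lt_castSucc_iff.1 hj))).div (hρ i) (hpos i).ne'

/-- If the normalized errors stay in a compact part of `(-1, 1)`, they do so in the limit. This goes
by induction along the cascade, since the `i`-th error depends continuously on the state only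
where the previous ones lie in `(-1, 1)`. -/
theorem Law.abs_xi_lt_one_of_tendsto [l.NeBot] (hpos : ∀ i, 0 < L.ρ i t₀)
    (hρ : ∀ i, Tendsto (fun a => L.ρ i (s a)) l (𝓝 (L.ρ i t₀))) (hμ : Tendsto μ₁ l (𝓝 a₀))
    (hz : Tendsto z l (𝓝 z₀))
    (hδ : ∀ i, ∃ c < 1, ∀ᶠ a in l, |L.xi (s a) (μ₁ a) (z a) i| ≤ c) (i : Fin n) :
    |L.xi t₀ a₀ z₀ i| < 1 := by
  induction i using WellFoundedLT.induction with
  | ind i ih =>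
    obtain ⟨c, hc, hev⟩ := hδ i
    exact (le_of_tendsto (Law.tendsto_xi hpos hρ hμ hz i ih).abs hev).trans_lt hc

end

section
variable {p n m : ℕ} [NeZero n] [NeZero m]

theorem StrictFeedback.regularAt_closedLoop {S : StrictFeedback p n}
    (hS : ContDiff ℝ 1 (S.plant (m := m))) {L : Law n}
    (hρ : ∀ i, ContinuousOn (L.ρ i) (Ici 0)) {N : ℝ → XSpace p × (Fin m → ℝ) → ℝ}
    (hN : IsRegularFeedback N) {t₀ : ℝ} (ht₀ : 0 ≤ t₀) (hpos : ∀ i, 0 < L.ρ i t₀)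
    {y₀ : State p m n} (hξ : ∀ i, |L.xi t₀ (y₀.2.1 0) y₀.z i| < 1) :
    RegularAt (S.closedLoop L N) t₀ y₀ := by
  let Φ : (Fin n → ℝ) × ℝ × State p m n → State p m n := fun v =>
    S.plant (v.2.1, (L.freeze v.1).eta 0 (v.2.2.2.1 0) v.2.2.z (Fin.last n), v.2.2)
  let Q : ℝ → State p m n → (Fin n → ℝ) × ℝ × State p m n := fun t y =>
    (fun i => L.ρ i t, N t (y.1, y.2.1), y)
  have hΦQ : ∀ t, S.closedLoop L N t = Φ ∘ Q t := fun t => rfl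
  have hΦQ' : Function.uncurry (S.closedLoop L N) = Φ ∘ Function.uncurry Q := funext fun q => rfl
  have hη := L.contDiffAt_eta (r₀ := fun i => L.ρ i t₀) hpos (Fin.last n) (fun j _ => hξ j)
  have hz : ContDiff ℝ 1 (fun v : (Fin n → ℝ) × ℝ × State p m n =>
      (v.1, v.2.2.2.1 0, v.2.2.z)) :=
    ContDiff.prodMk (by fun_prop) (ContDiff.prodMk (by fun_prop)
      (State.contDiff_z.comp (by fun_prop)))
  have hu : ContDiffAt ℝ 1 (fun v : (Fin n → ℝ) × ℝ × State p m n =>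
      (L.freeze v.1).eta 0 (v.2.2.2.1 0) v.2.2.z (Fin.last n)) (Q t₀ y₀) :=
    ContDiffAt.comp (f := fun v : (Fin n → ℝ) × ℝ × State p m n => (v.1, v.2.2.2.1 0, v.2.2.z))
      (g := fun v : (Fin n → ℝ) × ℝ × (Fin n → ℝ) => (L.freeze v.1).eta 0 v.2.1 v.2.2 (Fin.last n))
      (Q t₀ y₀) hη hz.contDiffAt
  have hΦ : ContDiffAt ℝ 1 Φ (Q t₀ y₀) :=
    ContDiffAt.comp (g := S.plant) (Q t₀ y₀) hS.contDiffAt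
      (ContDiffAt.prodMk (by fun_prop) (ContDiffAt.prodMk hu (by fun_prop)))
  obtain ⟨K, W, hW, hlip⟩ := hΦ.exists_lipschitzOnWith
  have hQ : ContinuousOn (Function.uncurry Q) (Ici 0 ×ˢ univ) := by
    refine ContinuousOn.prodMk ?_ (ContinuousOn.prodMk ?_ (by fun_prop))
    · exact continuousOn_pi.2 fun i => (hρ i).comp continuousOn_fst fun q hq => hq.1
    · exact hN.continuousOn.comp (f := fun q : ℝ × State p m n => (q.1, (q.2.1, q.2.2.1)))
        (by fun_prop) fun q hq => ⟨hq.1, trivial⟩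
  have hpre : Function.uncurry Q ⁻¹' W ∈ 𝓝[Ici 0] t₀ ×ˢ 𝓝 y₀ := by
    have := (hQ (t₀, y₀) ⟨ht₀, trivial⟩) hW
    rwa [nhdsWithin_prod_eq, nhdsWithin_univ] at this
  have hproj : LipschitzWith 1 (fun y : State p m n => (y.1, y.2.1)) := by
    have := LipschitzWith.prodMk (LipschitzWith.prod_fst (α := XSpace p)
      (β := (Fin m → ℝ) × (Fin n → ℝ))) ((LipschitzWith.prod_fst (α := Fin m → ℝ)
      (β := Fin n → ℝ)).comp (LipschitzWith.prod_snd (α := XSpace p)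
      (β := (Fin m → ℝ) × (Fin n → ℝ))))
    simpa [Function.comp_def] using this
  have hQlip : ∀ t K' U₂, LipschitzOnWith K' (N t) U₂ → ∀ U : Set (State p m n),
      MapsTo (fun y : State p m n => (y.1, y.2.1)) U U₂ →
      LipschitzOnWith (max 0 (max (K' * 1) 1)) (Q t) U := fun t K' U₂ hlipN U hU =>
    LipschitzOnWith.prodMk (LipschitzWith.const (fun i => L.ρ i t)).lipschitzOnWith
      (LipschitzOnWith.prodMk (hlipN.comp hproj.lipschitzOnWith hU)
        LipschitzWith.id.lipschitzOnWith)
  clear_value Φ Q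
  obtain ⟨V₁, hV₁, U₁, hU₁, hVU⟩ := mem_prod_iff.1 hpre
  obtain ⟨K', V₂, hV₂, U₂, hU₂, hlipN⟩ := hN.lipschitz t₀ ht₀ (y₀.1, y₀.2.1)
  refine ⟨K * max 0 (max (K' * 1) 1), V₁ ∩ V₂ ∩ Ici 0,
    inter_mem (inter_mem hV₁ hV₂) self_mem_nhdsWithin,
    U₁ ∩ (fun y : State p m n => (y.1, y.2.1)) ⁻¹' U₂,
    inter_mem hU₁ (hproj.continuous.continuousAt.preimage_mem_nhds hU₂), fun t ht => ?_, ?_⟩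
  · have hmaps : MapsTo (Q t) (U₁ ∩ (fun y : State p m n => (y.1, y.2.1)) ⁻¹' U₂) W :=
      fun y hy => hVU (show (t, y) ∈ V₁ ×ˢ U₁ from ⟨ht.1.1, hy.1⟩)
    rw [hΦQ t]
    exact hlip.comp (hQlip t _ _ (hlipN t ht.1.2) _ fun y hy => hy.2) hmaps
  · have hmaps : MapsTo (Function.uncurry Q)
        ((V₁ ∩ V₂ ∩ Ici 0) ×ˢ (U₁ ∩ (fun y : State p m n => (y.1, y.2.1)) ⁻¹' U₂)) W :=
      fun q hq => hVU (show q ∈ V₁ ×ˢ U₁ from ⟨hq.1.1.1, hq.2.1⟩)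
    have hQ' := hQ.mono (t := (V₁ ∩ V₂ ∩ Ici 0) ×ˢ
      (U₁ ∩ (fun y : State p m n => (y.1, y.2.1)) ⁻¹' U₂)) fun q hq => ⟨hq.1.2, trivial⟩
    rw [hΦQ']
    exact hlip.continuousOn.comp hQ' hmaps

end

/-! ### Bounded functions on a set -/

/-- `f` is bounded on `D`. -/
def BoundedOn {E : Type*} [Norm E] (f : ℝ → E) (D : Set ℝ) : Prop := ∃ C : ℝ, ∀ t ∈ D, ‖f t‖ ≤ C

section
variable {E : Type*} [NormedAddCommGroup E] {D : Set ℝ}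

theorem BoundedOn.mono {f : ℝ → E} {D' : Set ℝ} (hf : BoundedOn f D) (h : D' ⊆ D) :
    BoundedOn f D' :=
  let ⟨C, hC⟩ := hf; ⟨C, fun t ht => hC t (h ht)⟩

theorem boundedOn_const (a : E) : BoundedOn (fun _ => a) D := ⟨‖a‖, fun _ _ => le_rfl⟩

theorem BoundedOn.add {f g : ℝ → E} (hf : BoundedOn f D) (hg : BoundedOn g D) :
    BoundedOn (fun t => f t + g t) D :=
  let ⟨A, hA⟩ := hf; let ⟨B, hB⟩ := hg
  ⟨A + B, fun t ht => (norm_add_le _ _).trans (add_le_add (hA t ht) (hB t ht))⟩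

theorem BoundedOn.sub {f g : ℝ → E} (hf : BoundedOn f D) (hg : BoundedOn g D) :
    BoundedOn (fun t => f t - g t) D :=
  let ⟨A, hA⟩ := hf; let ⟨B, hB⟩ := hg
  ⟨A + B, fun t ht => (norm_sub_le _ _).trans (add_le_add (hA t ht) (hB t ht))⟩

theorem BoundedOn.mul {f g : ℝ → ℝ} (hf : BoundedOn f D) (hg : BoundedOn g D) :
    BoundedOn (fun t => f t * g t) D :=
  let ⟨A, hA⟩ := hf; let ⟨B, hB⟩ := hg
  ⟨A * B, fun t ht => (norm_mul_le _ _).trans (mul_le_mul (hA t ht) (hB t ht) (norm_nonneg _)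
    ((norm_nonneg _).trans (hA t ht)))⟩

theorem BoundedOn.prodMk {F : Type*} [NormedAddCommGroup F] {f : ℝ → E} {g : ℝ → F}
    (hf : BoundedOn f D) (hg : BoundedOn g D) : BoundedOn (fun t => (f t, g t)) D :=
  let ⟨A, hA⟩ := hf; let ⟨B, hB⟩ := hg
  ⟨max A B, fun t ht => max_le_max (hA t ht) (hB t ht)⟩

theorem boundedOn_pi {ι : Type*} [Fintype ι] {f : ℝ → ι → ℝ}
    (h : ∀ i, BoundedOn (fun t => f t i) D) : BoundedOn f D := by
  choose C hC using h
  refine ⟨∑ i, |C i|, fun t ht => (pi_norm_le_iff_of_nonneg (by positivity)).2 fun i => ?_⟩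
  exact (hC i t ht).trans ((le_abs_self _).trans
    (Finset.single_le_sum (f := fun i => |C i|) (fun j _ => abs_nonneg _) (Finset.mem_univ i)))

theorem BoundedOn.comp_continuousOn {F : Type*} [NormedAddCommGroup F] [ProperSpace E]
    {f : ℝ → E} {A : Set E} {g : E → F} (hf : BoundedOn f D) (hA : IsClosed A)
    (hfA : ∀ t ∈ D, f t ∈ A) (hg : ContinuousOn g A) : BoundedOn (fun t => g (f t)) D := by
  obtain ⟨C, hC⟩ := hf
  obtain ⟨B, hB⟩ := ((isCompact_closedBall (0 : E) C).inter_right hA).exists_bound_of_continuousOn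
    (hg.mono inter_subset_right)
  exact ⟨B, fun t ht => hB _ ⟨mem_closedBall_zero_iff.2 (hC t ht), hfA t ht⟩⟩

theorem BoundedOn.comp_continuous {F : Type*} [NormedAddCommGroup F] [ProperSpace E]
    {f : ℝ → E} {g : E → F} (hf : BoundedOn f D) (hg : Continuous g) :
    BoundedOn (fun t => g (f t)) D :=
  hf.comp_continuousOn isClosed_univ (fun _ _ => trivial) hg.continuousOn

end

/-! ### The barrier argument -/

/-- If `ξ < 1` decreases wherever `log ((1 + ξ) / (1 - ξ))` is large, then `ξ` stays away
from `1`. -/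
theorem exists_upper_barrier {ξ ξ' : ℝ → ℝ} {τ M : ℝ}
    (hξ : ∀ t ∈ Ico 0 τ, HasDerivWithinAt ξ (ξ' t) (Ico 0 τ) t)
    (hlt : ∀ t ∈ Ico 0 τ, ξ t < 1)
    (hneg : ∀ t ∈ Ico 0 τ, M ≤ Real.log ((1 + ξ t) / (1 - ξ t)) → ξ' t < 0) :
    ∃ c < 1, ∀ t ∈ Ico 0 τ, ξ t ≤ c := by
  rcases le_or_gt τ 0 with hτ | hτ
  · exact ⟨0, one_pos, fun t ht => absurd (ht.1.trans_lt ht.2) hτ.not_gt⟩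
  have hM := Real.exp_pos M
  -- the number `a` solves `log ((1 + a) / (1 - a)) = M`
  set a : ℝ := (Real.exp M - 1) / (Real.exp M + 1) with ha
  have ha1 : a < 1 := by rw [ha, div_lt_one (by linarith)]; linarith
  refine ⟨max (ξ 0) a, max_lt (hlt 0 ⟨le_rfl, hτ⟩) ha1, fun t ht => ?_⟩
  have hsub : Icc 0 t ⊆ Ico 0 τ := fun s hs => ⟨hs.1, hs.2.trans_lt ht.2⟩
  refine image_le_of_deriv_right_lt_deriv_boundary (f' := ξ') (B := fun _ => max (ξ 0) a)
    (B' := fun _ => 0) (fun s hs => (hξ s (hsub hs)).continuousWithinAt.mono hsub)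
    (fun s hs => ?_) (le_max_left _ _) (fun s => hasDerivAt_const _ _) (fun s hs hB => ?_)
    (right_mem_Icc.2 ht.1)
  · have hs' := hsub (Ico_subset_Icc_self hs)
    exact (hξ s hs').mono_of_mem_nhdsWithin
      (mem_of_superset (Ico_mem_nhdsGE hs'.2) (Ico_subset_Ico_left hs.1))
  · have hs' := hsub (Ico_subset_Icc_self hs)
    refine hneg s hs' ?_
    have h1 : 0 < 1 - ξ s := by linarith [hlt s hs']
    have h2 : a ≤ ξ s := hB ▸ le_max_right _ _
    have h3 : Real.exp M - 1 ≤ ξ s * (Real.exp M + 1) := (div_le_iff₀ (by linarith)).1 h2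
    have h4 : Real.exp M ≤ (1 + ξ s) / (1 - ξ s) := by
      rw [le_div_iff₀ h1]; linarith
    exact (Real.le_log_iff_exp_le (hM.trans_le h4)).2 h4

/-- The logarithm in the control law is an odd function of the normalized error. -/
theorem log_div_neg (a : ℝ) :
    Real.log ((1 + -a) / (1 - -a)) = -Real.log ((1 + a) / (1 - a)) := by
  rw [← Real.log_inv, inv_div, sub_neg_eq_add, ← sub_eq_add_neg]

theorem hasDerivWithinAt_log_div {ξ : ℝ → ℝ} {ξ' t : ℝ} {D : Set ℝ}
    (h : HasDerivWithinAt ξ ξ' D t) (hξ : |ξ t| < 1) :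
    HasDerivWithinAt (fun t => Real.log ((1 + ξ t) / (1 - ξ t)))
      ((1 + ξ t)⁻¹ * ξ' + (1 - ξ t)⁻¹ * ξ') D t := by
  have h1 := abs_lt.1 hξ
  have h2 : 0 < 1 + ξ t := by linarith
  have h3 : 0 < 1 - ξ t := by linarith
  have hq : HasDerivWithinAt (fun t => (1 + ξ t) / (1 - ξ t))
      ((ξ' * (1 - ξ t) - (1 + ξ t) * -ξ') / (1 - ξ t) ^ 2) D t :=
    (h.const_add 1).div (h.const_sub 1) h3.ne'
  refine (hq.log (div_pos h2 h3).ne').congr_deriv ?_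
  field_simp
  ring

/-- One step of the cascade. For bounded data and a control coefficient `γ` bounded away from `0`,
the feedback `- k log ((1 + ξ) / (1 - ξ))` keeps the normalized error `ξ` in a compact part
of `(-1, 1)`; hence the feedback and its derivative are bounded. -/
theorem boundedOn_feedback {τ k b r₀ : ℝ} {z η η' r r' γ φ ξ V : ℝ → ℝ}
    (hk : 0 < k) (hb : 0 < b) (hr₀ : 0 < r₀)
    (hξ : ξ = fun t => (z t - η t) / r t)
    (hV : V = fun t => Real.log ((1 + ξ t) / (1 - ξ t)))
    (hz : ∀ t ∈ Ico 0 τ, HasDerivWithinAt z (φ t - γ t * k * V t) (Ico 0 τ) t)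
    (hη : ∀ t ∈ Ico 0 τ, HasDerivWithinAt η (η' t) (Ico 0 τ) t)
    (hr : ∀ t ∈ Ico 0 τ, HasDerivWithinAt r (r' t) (Ico 0 τ) t)
    (hrlow : ∀ t ∈ Ico 0 τ, r₀ ≤ r t) (hγlow : ∀ t ∈ Ico 0 τ, b ≤ γ t)
    (hφ : BoundedOn φ (Ico 0 τ)) (hγ : BoundedOn γ (Ico 0 τ)) (hη' : BoundedOn η' (Ico 0 τ))
    (hr' : BoundedOn r' (Ico 0 τ)) (hξ1 : ∀ t ∈ Ico 0 τ, |ξ t| < 1) :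
    (∃ c < 1, ∀ t ∈ Ico 0 τ, |ξ t| ≤ c) ∧ BoundedOn V (Ico 0 τ) ∧
      ∃ V' : ℝ → ℝ, (∀ t ∈ Ico 0 τ, HasDerivWithinAt V (V' t) (Ico 0 τ) t) ∧
        BoundedOn V' (Ico 0 τ) := by
  obtain ⟨A, hA⟩ := id hφ
  obtain ⟨B, hB⟩ := id hη'
  obtain ⟨C, hC⟩ := id hr'
  set ξ' : ℝ → ℝ := fun t => (φ t - γ t * k * V t - η' t - ξ t * r' t) / r t with hξ'
  have hrpos : ∀ t ∈ Ico 0 τ, 0 < r t := fun t ht => hr₀.trans_le (hrlow t ht)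
  have hder : ∀ t ∈ Ico 0 τ, HasDerivWithinAt ξ (ξ' t) (Ico 0 τ) t := fun t ht => by
    have h := ((hz t ht).sub (hη t ht)).div (hr t ht) (hrpos t ht).ne'
    have h0 := (hrpos t ht).ne'
    rw [hξ]
    refine h.congr_deriv ?_
    simp only [hξ', Pi.sub_apply]
    rw [show ξ t = (z t - η t) / r t from congrFun hξ t]
    field_simp
  set M : ℝ := (A + B + C + 1) / (b * k) with hM
  -- the sum of the disturbances is at most `A + B + C`, the feedback exceeds it if `V ≥ M`
  have hdist : ∀ t ∈ Ico 0 τ, |φ t - η' t - ξ t * r' t| ≤ A + B + C := fun t ht => by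
    have h1 := hA t ht
    have h2 := hB t ht
    have h3 := hC t ht
    rw [Real.norm_eq_abs] at h1 h2 h3
    have h4 : |ξ t * r' t| ≤ C := by
      rw [abs_mul]
      exact (mul_le_of_le_one_left (abs_nonneg _) (hξ1 t ht).le).trans h3
    calc _ ≤ |φ t - η' t| + |ξ t * r' t| := abs_sub _ _
      _ ≤ |φ t| + |η' t| + |ξ t * r' t| := by gcongr; exact abs_sub _ _
      _ ≤ _ := by linarith
  have hpush : ∀ t ∈ Ico 0 τ, ∀ v, M ≤ v → A + B + C + 1 ≤ γ t * k * v := fun t ht v hv => by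
    have h0 : 0 ≤ A + B + C := (abs_nonneg _).trans (hdist t ht)
    have h1 : A + B + C + 1 ≤ b * k * v := by
      rw [hM, div_le_iff₀ (by positivity)] at hv; linarith
    have h2 : 0 ≤ v := (show 0 ≤ M by positivity).trans hv
    have h3 := hγlow t ht
    calc _ ≤ b * k * v := h1
      _ ≤ _ := by gcongr
  obtain ⟨c₁, hc₁, hup⟩ := exists_upper_barrier (M := M) hder (fun t ht => (abs_lt.1 (hξ1 t ht)).2)
    fun t ht hlog => by
      have h1 := hpush t ht (V t) (by rw [hV]; exact hlog)
      have h2 := (abs_le.1 (hdist t ht)).2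
      exact div_neg_of_neg_of_pos (by linarith) (hrpos t ht)
  obtain ⟨c₂, hc₂, hlow⟩ := exists_upper_barrier (M := M) (ξ := fun t => -ξ t)
    (fun t ht => (hder t ht).neg) (fun t ht => by linarith [(abs_lt.1 (hξ1 t ht)).1])
    fun t ht hlog => by
      rw [log_div_neg] at hlog
      have h1 := hpush t ht (-V t) (by rw [hV]; exact hlog)
      have h2 := (abs_le.1 (hdist t ht)).1
      exact neg_neg_of_pos (div_pos (by linarith) (hrpos t ht))
  set c := max c₁ c₂ with hc
  have hc1 : c < 1 := max_lt hc₁ hc₂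
  have habs : ∀ t ∈ Ico 0 τ, |ξ t| ≤ c := fun t ht => abs_le'.2
    ⟨(hup t ht).trans (le_max_left _ _), (hlow t ht).trans (le_max_right _ _)⟩
  have hξb : BoundedOn ξ (Ico 0 τ) := ⟨c, habs⟩
  have hmem : ∀ t ∈ Ico 0 τ, ξ t ∈ Icc (-c) c := fun t ht => abs_le.1 (habs t ht)
  have hplus : ∀ v ∈ Icc (-c) c, 1 + v ≠ 0 := fun v hv => by linarith [hv.1]
  have hminus : ∀ v ∈ Icc (-c) c, 1 - v ≠ 0 := fun v hv => by linarith [hv.2]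
  have hcp : ContinuousOn (fun v : ℝ => 1 + v) (Icc (-c) c) := by fun_prop
  have hcm : ContinuousOn (fun v : ℝ => 1 - v) (Icc (-c) c) := by fun_prop
  have hVb : BoundedOn V (Ico 0 τ) := by
    rw [hV]
    exact hξb.comp_continuousOn (g := fun v => Real.log ((1 + v) / (1 - v))) isClosed_Icc hmem
      ((hcp.div hcm hminus).log fun v hv => div_ne_zero (hplus v hv) (hminus v hv))
  have hrinv : BoundedOn (fun t => (r t)⁻¹) (Ico 0 τ) := ⟨r₀⁻¹, fun t ht => by
    rw [norm_inv, Real.norm_of_nonneg (hrpos t ht).le]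
    exact inv_anti₀ hr₀ (hrlow t ht)⟩
  have hξ'b : BoundedOn ξ' (Ico 0 τ) :=
    (((hφ.sub ((hγ.mul (boundedOn_const k)).mul hVb)).sub hη').sub (hξb.mul hr')).mul hrinv
  refine ⟨⟨c, hc1, habs⟩, hVb, fun t => (1 + ξ t)⁻¹ * ξ' t + (1 - ξ t)⁻¹ * ξ' t,
    fun t ht => ?_, ?_⟩
  · rw [hV]
    exact hasDerivWithinAt_log_div (hder t ht) (hξ1 t ht)
  · exact ((hξb.comp_continuousOn (g := fun v => (1 + v)⁻¹) isClosed_Icc hmem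
      (hcp.inv₀ hplus)).mul hξ'b).add ((hξb.comp_continuousOn (g := fun v => (1 - v)⁻¹)
      isClosed_Icc hmem (hcm.inv₀ hminus)).mul hξ'b)

/-! ### Bounds along the cascade -/

section
variable {p n m : ℕ} [NeZero n] [NeZero m] {S : StrictFeedback p n} {L : Law n}
  {N : ℝ → XSpace p × (Fin m → ℝ) → ℝ}

/-- In the variables `z` the whole tracking subsystem has the form `zᵢ' = fᵢ + gᵢ zᵢ₊₁`: the term
`- μ₁'` in the equation of `e` cancels in that of `z₁ = e + μ₁`. -/
theorem SolvesOn.hasDerivWithinAt_z {y : ℝ → State p m n} {D : Set ℝ}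
    (hy : SolvesOn (S.closedLoop L N) D y) {t : ℝ} (ht : t ∈ D) (i : Fin n) :
    HasDerivWithinAt (fun s => (y s).z i)
      (S.f i (y t).1 (initialPart (y t).z i) + S.g i (y t).1 (initialPart (y t).z i)
        * following (y t).z (L.input t ((y t).2.1 0) (y t).z) i) D t := by
  have hw := hasDerivWithinAt_pi.1 (hy t ht).snd.snd i
  by_cases hi : i = 0
  · subst hi
    have hμ := hasDerivWithinAt_pi.1 (hy t ht).snd.fst 0
    have := hw.add hμ
    simp only [State.z, fullState, Function.update_self]
    refine this.congr_deriv ?_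
    simp only [StrictFeedback.closedLoop, StrictFeedback.plant, if_true, State.z, fullState]
    ring
  · simp only [State.z, fullState, Function.update_of_ne hi]
    refine hw.congr_deriv ?_
    simp only [StrictFeedback.closedLoop, StrictFeedback.plant, if_neg hi, sub_zero, State.z,
      fullState]

/-- The cascade: on a bounded time interval on which the normalized errors lie in `(-1, 1)`, and
`x`, `μ₁`, `μ₁'` are bounded, the normalized errors stay in a compact part of `(-1, 1)`, and the
`zᵢ` and the control input are bounded. -/
theorem SolvesOn.boundedOn_cascade (hf : ∀ i, Continuous (Function.uncurry (S.f i)))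
    (hg : ∀ i, Continuous (Function.uncurry (S.g i)))
    (hsign : ∀ i x y, SignType.sign (S.g i x y) = L.s i)
    (hbound : ∀ i, ∃ b : ℝ, 0 < b ∧ ∀ x y, b ≤ |S.g i x y|)
    (hk : ∀ i, 0 < L.k i) (hρpos : ∀ i, ∀ t : ℝ, 0 ≤ t → 0 < L.ρ i t)
    (hρ : ∀ i, ContDiffOn ℝ 1 (L.ρ i) (Ici 0)) {y : ℝ → State p m n} {τ : ℝ}
    (hy : SolvesOn (S.closedLoop L N) (Ico 0 τ) y)
    (hx : BoundedOn (fun t => (y t).1) (Ico 0 τ))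
    (hμ : BoundedOn (fun t => (y t).2.1 0) (Ico 0 τ))
    (hμ' : BoundedOn (fun t => following (y t).2.1 (N t ((y t).1, (y t).2.1)) 0) (Ico 0 τ))
    (hξ : ∀ t ∈ Ico 0 τ, ∀ i, |L.xi t ((y t).2.1 0) (y t).z i| < 1) :
    (∀ i, BoundedOn (fun t => (y t).z i) (Ico 0 τ)) ∧
      BoundedOn (fun t => L.input t ((y t).2.1 0) (y t).z) (Ico 0 τ) ∧
      ∀ i, ∃ c < 1, ∀ t ∈ Ico 0 τ, |L.xi t ((y t).2.1 0) (y t).z i| ≤ c := by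
  rcases le_or_gt τ 0 with hτ | hτ
  · have hD : Ico 0 τ = ∅ := Ico_eq_empty hτ.not_gt
    simp only [hD, BoundedOn, mem_empty_iff_false, false_imp_iff, implies_true, exists_const,
      and_true, true_and]
    exact fun _ => ⟨0, one_pos⟩
  have hDI : Ico 0 τ ⊆ Icc 0 τ := Ico_subset_Icc_self
  have hI : Icc 0 τ ⊆ Ici 0 := fun t ht => ht.1
  have hρb : ∀ i, BoundedOn (L.ρ i) (Ico 0 τ) := fun i => by
    obtain ⟨C, hC⟩ := isCompact_Icc.exists_bound_of_continuousOn ((hρ i).continuousOn.mono hI)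
    exact ⟨C, fun t ht => hC t (hDI ht)⟩
  have hρ'b : ∀ i, BoundedOn (derivWithin (L.ρ i) (Ici 0)) (Ico 0 τ) := fun i => by
    obtain ⟨C, hC⟩ := isCompact_Icc.exists_bound_of_continuousOn
      (((hρ i).continuousOn_derivWithin (uniqueDiffOn_Ici 0) le_rfl).mono hI)
    exact ⟨C, fun t ht => hC t (hDI ht)⟩
  have hρlow : ∀ i, ∃ r > 0, ∀ t ∈ Ico 0 τ, r ≤ L.ρ i t := fun i => by
    obtain ⟨t₀, ht₀, hmin⟩ := isCompact_Icc.exists_isMinOn (nonempty_Icc.2 hτ.le)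
      ((hρ i).continuousOn.mono hI)
    exact ⟨L.ρ i t₀, hρpos i t₀ ht₀.1, fun t ht => hmin (hDI ht)⟩
  have hρder : ∀ i, ∀ t ∈ Ico 0 τ,
      HasDerivWithinAt (L.ρ i) (derivWithin (L.ρ i) (Ici 0) t) (Ico 0 τ) t := fun i t ht =>
    ((((hρ i).differentiableOn one_ne_zero) t ht.1).hasDerivWithinAt).mono (hDI.trans hI)
  have hρξ : ∀ i, BoundedOn (fun t => L.ρ i t * L.xi t ((y t).2.1 0) (y t).z i) (Ico 0 τ) :=
    fun i => (hρb i).mul ⟨1, fun t ht => (hξ t ht i).le⟩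
  have hzη : ∀ i, ∀ t ∈ Ico 0 τ, (y t).z i = L.eta t ((y t).2.1 0) (y t).z i.castSucc
      + L.ρ i t * L.xi t ((y t).2.1 0) (y t).z i := fun i t ht => by
    have := (hρpos i t ht.1).ne'
    rw [Law.xi]
    field_simp
    ring
  have key : ∀ i : Fin (n + 1),
      BoundedOn (fun t => L.eta t ((y t).2.1 0) (y t).z i) (Ico 0 τ) ∧
      (∃ η' : ℝ → ℝ, (∀ t ∈ Ico 0 τ, HasDerivWithinAt
        (fun s => L.eta s ((y s).2.1 0) (y s).z i) (η' t) (Ico 0 τ) t) ∧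
        BoundedOn η' (Ico 0 τ)) ∧
      ∀ j : Fin n, j.castSucc < i → BoundedOn (fun t => (y t).z j) (Ico 0 τ) ∧
        ∃ c < 1, ∀ t ∈ Ico 0 τ, |L.xi t ((y t).2.1 0) (y t).z j| ≤ c := by
    intro i
    induction i using Fin.induction with
    | zero =>
      refine ⟨hμ, ⟨_, fun t ht => hasDerivWithinAt_pi.1 (hy t ht).snd.fst 0, hμ'⟩, fun j hj => ?_⟩
      exact absurd hj (Fin.not_lt_zero _)
    | succ i ih =>
      obtain ⟨hη, ⟨η', hη', hη'b⟩, hprev⟩ := ih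
      have hzi : BoundedOn (fun t => (y t).z i) (Ico 0 τ) := by
        obtain ⟨C, hC⟩ := hη.add (hρξ i)
        exact ⟨C, fun t ht => by simpa only [hzη i t ht] using hC t ht⟩
      have hzle : ∀ j ≤ i, BoundedOn (fun t => (y t).z j) (Ico 0 τ) := fun j hj => by
        rcases hj.lt_or_eq with h | rfl
        · exact (hprev j (Fin.castSucc_lt_castSucc_iff.2 h)).1
        · exact hzi
      have hpart : BoundedOn (fun t => ((y t).1, initialPart (y t).z i)) (Ico 0 τ) :=
        hx.prodMk (boundedOn_pi fun j => hzle _ (Nat.lt_succ_iff.1 j.isLt))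
      have hfb := hpart.comp_continuous (hf i)
      have hgb := hpart.comp_continuous (hg i)
      -- `zᵢ₊₁` is `ηᵢ₊₁` up to the bounded disturbance `d`, which vanishes in the last step
      obtain ⟨d, hd, hnext⟩ : ∃ d : ℝ → ℝ, BoundedOn d (Ico 0 τ) ∧ ∀ t ∈ Ico 0 τ,
          following (y t).z (L.input t ((y t).2.1 0) (y t).z) i
            = L.eta t ((y t).2.1 0) (y t).z i.succ + d t := by
        rcases (Nat.succ_le_of_lt i.isLt).lt_or_eq with h | h
        · refine ⟨_, hρξ ⟨i + 1, h⟩, fun t ht => ?_⟩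
          rw [following_of_lt h, hzη _ t ht]
          rfl
        · refine ⟨fun _ => 0, boundedOn_const 0, fun t ht => ?_⟩
          have hlast : i.succ = Fin.last n := by ext; simpa using h
          rw [following_of_eq h, hlast, add_zero]
          rfl
      obtain ⟨b, hb, hbg⟩ := hbound i
      obtain ⟨r₀, hr₀, hrlow⟩ := hρlow i
      obtain ⟨hc, hVb, V', hV', hV'b⟩ := boundedOn_feedback (τ := τ)
        (z := fun t => (y t).z i) (r := L.ρ i)
        (φ := fun t => S.f i (y t).1 (initialPart (y t).z i)
          + S.g i (y t).1 (initialPart (y t).z i) * d t)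
        (γ := fun t => |S.g i (y t).1 (initialPart (y t).z i)|) (hk i) hb hr₀ rfl rfl
        (fun t ht => by
          refine (hy.hasDerivWithinAt_z ht i).congr_deriv ?_
          rw [hnext t ht, Law.eta_succ, ← self_mul_sign, hsign]
          rw [Law.xi]
          ring)
        hη' (hρder i) hrlow (fun t ht => hbg _ _) (hfb.add (hgb.mul hd))
        (by
          obtain ⟨C, hC⟩ := hgb
          exact ⟨C, fun t ht => by simpa using hC t ht⟩)
        hη'b (hρ'b i) (fun t ht => hξ t ht i)
      have heq : (fun s => L.eta s ((y s).2.1 0) (y s).z i.succ) = fun s =>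
          -((L.s i : ℝ) * L.k i) * Real.log ((1 + L.xi s ((y s).2.1 0) (y s).z i)
            / (1 - L.xi s ((y s).2.1 0) (y s).z i)) := by
        funext s
        rw [Law.eta_succ, neg_mul]
      rw [heq]
      refine ⟨(boundedOn_const _).mul hVb,
        ⟨_, fun t ht => (hV' t ht).const_mul _, (boundedOn_const _).mul hV'b⟩, fun j hj => ?_⟩
      rcases (Fin.castSucc_lt_succ_iff.1 hj).lt_or_eq with h | rfl
      · exact hprev j (Fin.castSucc_lt_castSucc_iff.2 h)
      · exact ⟨hzi, hc⟩
  have hall := (key (Fin.last n)).2.2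
  exact ⟨fun i => (hall i i.castSucc_lt_last).1, (key (Fin.last n)).1,
    fun i => (hall i i.castSucc_lt_last).2⟩

end

/-! ### Invariance and continuation -/

section
variable {p n m : ℕ} [NeZero n] [NeZero m] {S : StrictFeedback p n} {L : Law n}
  {N : ℝ → XSpace p × (Fin m → ℝ) → ℝ} {x₀ : XSpace p} {z₀ : Fin n → ℝ}

theorem abs_xi_initialState_lt_one (hρpos : ∀ i, 0 < L.ρ i 0)
    (hinit : ∀ i, i ≠ 0 → |z₀ i - L.eta 0 (z₀ 0) z₀ i.castSucc| < L.ρ i 0) (i : Fin n) :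
    |L.xi 0 ((initialState m x₀ z₀).2.1 0) (initialState m x₀ z₀).z i| < 1 := by
  have hμ : (initialState m x₀ z₀).2.1 0 = z₀ 0 := by
    simp [initialState]
  rw [initialState_z, hμ, Law.xi]
  by_cases hi : i = 0
  · subst hi
    simp [Law.eta_zero]
  · rw [abs_div, abs_of_pos (hρpos i), div_lt_one (hρpos i)]
    exact hinit i hi

/-- The region where all normalized errors lie in `(-1, 1)` is invariant. At the first time `τ` of
leaving it, `x` and `μ₁` are bounded on `[0, τ)` by continuity, so that the bounds along the
cascade exclude that some normalized error has modulus at least `1` at `τ`. -/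
theorem SolvesOn.abs_xi_lt_one (hf : ∀ i, Continuous (Function.uncurry (S.f i)))
    (hg : ∀ i, Continuous (Function.uncurry (S.g i)))
    (hsign : ∀ i x y, SignType.sign (S.g i x y) = L.s i)
    (hbound : ∀ i, ∃ b : ℝ, 0 < b ∧ ∀ x y, b ≤ |S.g i x y|)
    (hk : ∀ i, 0 < L.k i) (hρpos : ∀ i, ∀ t : ℝ, 0 ≤ t → 0 < L.ρ i t)
    (hρ : ∀ i, ContDiffOn ℝ 1 (L.ρ i) (Ici 0))
    (hinit : ∀ i, i ≠ 0 → |z₀ i - L.eta 0 (z₀ 0) z₀ i.castSucc| < L.ρ i 0)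
    {y : ℝ → State p m n} {T : EReal} (hy : SolvesOn (S.closedLoop L N) (timeDomain T) y)
    (hy0 : y 0 = initialState m x₀ z₀)
    (hμ' : BoundedOn (fun t => following (y t).2.1 (N t ((y t).1, (y t).2.1)) 0) (timeDomain T))
    {t : ℝ} (ht : t ∈ timeDomain T) (i : Fin n) :
    |L.xi t ((y t).2.1 0) (y t).z i| < 1 := by
  by_contra hbad
  set bad : Set ℝ := {s | s ∈ timeDomain T ∧ ∃ i, ¬|L.xi s ((y s).2.1 0) (y s).z i| < 1}
    with hbaddef
  have htbad : t ∈ bad := ⟨ht, i, hbad⟩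
  have hbdd : BddBelow bad := ⟨0, fun s hs => hs.1.1⟩
  set τ := sInf bad with hτ
  have hτ0 : 0 ≤ τ := le_csInf ⟨t, htbad⟩ fun s hs => hs.1.1
  have hτD : τ ∈ timeDomain T :=
    ⟨hτ0, (EReal.coe_le_coe_iff.2 (csInf_le hbdd htbad)).trans_lt ht.2⟩
  have hsub : Icc 0 τ ⊆ timeDomain T := fun s hs =>
    ⟨hs.1, (EReal.coe_le_coe_iff.2 hs.2).trans_lt hτD.2⟩
  have hsub' : Ico 0 τ ⊆ timeDomain T := Ico_subset_Icc_self.trans hsub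
  have hgood : ∀ s ∈ Ico 0 τ, ∀ i, |L.xi s ((y s).2.1 0) (y s).z i| < 1 := fun s hs i => by
    by_contra h
    exact hs.2.not_ge (csInf_le hbdd ⟨hsub' hs, i, h⟩)
  have hyc : ContinuousOn y (timeDomain T) := fun s hs => (hy s hs).continuousWithinAt
  have hρc : ∀ i, ContinuousWithinAt (L.ρ i) (timeDomain T) τ := fun i =>
    ((hρ i).continuousOn τ hτ0).mono fun s hs => hs.1
  have hytend : Tendsto y (𝓝[timeDomain T] τ) (𝓝 (y τ)) := hyc τ hτD
  have hztend : Tendsto (fun s => (y s).z) (𝓝[timeDomain T] τ) (𝓝 (y τ).z) :=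
    (State.contDiff_z.continuous.tendsto (y τ)).comp hytend
  have hμtend : Tendsto (fun s => (y s).2.1 0) (𝓝[timeDomain T] τ) (𝓝 ((y τ).2.1 0)) :=
    ((by fun_prop : Continuous fun v : State p m n => v.2.1 0).tendsto (y τ)).comp hytend
  have hgoodτ : ∀ i, |L.xi τ ((y τ).2.1 0) (y τ).z i| < 1 := by
    rcases hτ0.eq_or_lt with h | h
    · rw [← h, hy0]
      exact abs_xi_initialState_lt_one (fun i => hρpos i 0 le_rfl) hinit
    · have hyb : BoundedOn y (Ico 0 τ) := by
        obtain ⟨C, hC⟩ := isCompact_Icc.exists_bound_of_continuousOn (hyc.mono hsub)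
        exact ⟨C, fun s hs => hC s (Ico_subset_Icc_self hs)⟩
      have hcas := SolvesOn.boundedOn_cascade (N := N) hf hg hsign hbound hk hρpos hρ
        (fun s hs => (hy s (hsub' hs)).mono hsub') (hyb.comp_continuous continuous_fst)
        (hyb.comp_continuous (g := fun v => v.2.1 0) (by fun_prop)) (hμ'.mono hsub') hgood
      have hle : 𝓝[<] τ ≤ 𝓝[timeDomain T] τ :=
        nhdsWithin_le_iff.2 (mem_of_superset (Ico_mem_nhdsLT h) hsub')
      refine Law.abs_xi_lt_one_of_tendsto (l := 𝓝[<] τ) (s := id) (fun i => hρpos i τ hτ0)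
        (fun i => (hρc i).tendsto.mono_left hle) (hμtend.mono_left hle) (hztend.mono_left hle)
        fun i => ?_
      obtain ⟨c, hc, hle⟩ := hcas.2.2 i
      exact ⟨c, hc, by filter_upwards [Ico_mem_nhdsLT h] with s hs using hle s hs⟩
  have hev : ∀ᶠ s in 𝓝[timeDomain T] τ, ∀ i, |L.xi s ((y s).2.1 0) (y s).z i| < 1 :=
    eventually_all.2 fun i => (Law.tendsto_xi (s := id) (fun i => hρpos i τ hτ0)
      (fun i => (hρc i).tendsto) hμtend hztend i fun j _ => hgoodτ j).abs.eventually_lt_const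
        (hgoodτ i)
  have hne : (𝓝[bad] τ).NeBot :=
    mem_closure_iff_nhdsWithin_neBot.1 (csInf_mem_closure ⟨t, htbad⟩ hbdd)
  have hev' : ∀ᶠ s in 𝓝[bad] τ, ∀ i, |L.xi s ((y s).2.1 0) (y s).z i| < 1 :=
    hev.filter_mono (nhdsWithin_mono τ fun s hs => hs.1)
  obtain ⟨s, hs, hsbad⟩ := (hev'.and self_mem_nhdsWithin).exists
  obtain ⟨j, hj⟩ := hsbad.2
  exact hj (hs j)

/-- A solution on `[0, τ)` along which `x` and `μ` are bounded can be continued: by the bounds along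
the cascade its derivative is bounded, hence it converges at `τ`, and its limit lies in the
region where the closed loop is regular. -/
theorem SolvesOn.exists_extension_of_boundedOn (hS : ContDiff ℝ 1 (S.plant (m := m)))
    (hf : ∀ i, Continuous (Function.uncurry (S.f i)))
    (hg : ∀ i, Continuous (Function.uncurry (S.g i)))
    (hsign : ∀ i x y, SignType.sign (S.g i x y) = L.s i)
    (hbound : ∀ i, ∃ b : ℝ, 0 < b ∧ ∀ x y, b ≤ |S.g i x y|)
    (hk : ∀ i, 0 < L.k i) (hρpos : ∀ i, ∀ t : ℝ, 0 ≤ t → 0 < L.ρ i t)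
    (hρ : ∀ i, ContDiffOn ℝ 1 (L.ρ i) (Ici 0)) (hN : IsRegularFeedback N)
    {y : ℝ → State p m n} {τ : ℝ} (hτ : 0 < τ) (hy : SolvesOn (S.closedLoop L N) (Ico 0 τ) y)
    (hxμ : BoundedOn (fun t => ((y t).1, (y t).2.1)) (Ico 0 τ))
    (hξ : ∀ t ∈ Ico 0 τ, ∀ i, |L.xi t ((y t).2.1 0) (y t).z i| < 1) :
    ∃ ε > 0, ∃ y' : ℝ → State p m n, EqOn y' y (Ico 0 τ) ∧
      SolvesOn (S.closedLoop L N) (Ico 0 (τ + ε)) y' := by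
  have hx := hxμ.comp_continuous continuous_fst
  have hμ := hxμ.comp_continuous continuous_snd
  have hμ0 : BoundedOn (fun t => (y t).2.1 0) (Ico 0 τ) :=
    hμ.comp_continuous (continuous_apply (0 : Fin m))
  have hid : BoundedOn (fun t : ℝ => t) (Ico 0 τ) :=
    ⟨τ, fun t ht => by rw [Real.norm_of_nonneg ht.1]; exact ht.2.le⟩
  have hNb : BoundedOn (fun t => N t ((y t).1, (y t).2.1)) (Ico 0 τ) :=
    (hid.prodMk hxμ).comp_continuousOn (isClosed_Ici.prod isClosed_univ)
      (fun t ht => ⟨ht.1, trivial⟩) hN.continuousOn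
  obtain ⟨hz, hu, hc⟩ := hy.boundedOn_cascade hf hg hsign hbound hk hρpos hρ hx hμ0
    ((hμ.prodMk hNb).comp_continuous (contDiff_following 0).continuous) hξ
  have hw : BoundedOn (fun t => (y t).2.2) (Ico 0 τ) := boundedOn_pi fun i => by
    by_cases hi : i = 0
    · subst hi
      simpa [State.z, fullState] using (hz 0).sub hμ0
    · simpa [State.z, fullState, hi] using hz i
  have hF : BoundedOn (fun t => S.closedLoop L N t (y t)) (Ico 0 τ) :=
    (hNb.prodMk (hu.prodMk (hx.prodMk (hμ.prodMk hw)))).comp_continuous hS.continuous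
  obtain ⟨C, hC⟩ := hF
  obtain ⟨l, hl⟩ := exists_tendsto_of_bounded_deriv hτ hy hC
  have hρc : ∀ i, ContinuousOn (L.ρ i) (Ici 0) := fun i => (hρ i).continuousOn
  have hgood : ∀ i, |L.xi τ (l.2.1 0) l.z i| < 1 := by
    refine Law.abs_xi_lt_one_of_tendsto (l := 𝓝[<] τ) (s := id) (fun i => hρpos i τ hτ.le)
      (fun i => ?_) (((by fun_prop : Continuous fun v : State p m n => v.2.1 0).tendsto l).comp hl)
      ((State.contDiff_z.continuous.tendsto l).comp hl) fun i => ?_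
    · exact (((hρc i).continuousAt (Ici_mem_nhds hτ)).tendsto).mono_left nhdsWithin_le_nhds
    · obtain ⟨c, hc, hle⟩ := hc i
      exact ⟨c, hc, by filter_upwards [Ico_mem_nhdsLT hτ] with s hs using hle s hs⟩
  exact hy.exists_extension hτ hl
    (StrictFeedback.regularAt_closedLoop hS hρc hN hτ.le (fun i => hρpos i τ hτ.le) hgood)

theorem exists_isMaximalSolution (hS : ContDiff ℝ 1 (S.plant (m := m)))
    (hρpos : ∀ i, 0 < L.ρ i 0) (hρ : ∀ i, ContinuousOn (L.ρ i) (Ici 0))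
    (hinit : ∀ i, i ≠ 0 → |z₀ i - L.eta 0 (z₀ 0) z₀ i.castSucc| < L.ρ i 0)
    (hN : IsRegularFeedback N) :
    ∃ (T : EReal) (x : ℝ → XSpace p) (μ : ℝ → Fin m → ℝ) (w : ℝ → Fin n → ℝ),
      IsMaximalSolution S L x₀ z₀ N T x μ w := by
  have hreg := StrictFeedback.regularAt_closedLoop hS hρ hN le_rfl hρpos
    (abs_xi_initialState_lt_one (m := m) (x₀ := x₀) hρpos hinit)
  obtain ⟨ε, hε, v, hv0, hv⟩ := hreg.exists_solvesOn le_rfl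
  rw [zero_add] at hv
  obtain ⟨T, y, ⟨hT, hy0, hy⟩, hmax⟩ := exists_maximal_solution (F := S.closedLoop L N)
    (y₀ := initialState m x₀ z₀) ⟨(ε : EReal), v, by exact_mod_cast hε, hv0, by
      rw [timeDomain_coe]
      exact fun t ht => (hv t (Ico_subset_Icc_self ht)).mono Ico_subset_Icc_self⟩
  refine ⟨T, fun t => (y t).1, fun t => (y t).2.1, fun t => (y t).2.2,
    isSolution_iff.2 ⟨hT, hy0, hy⟩, fun T' x' μ' w' hsol hx hμ hw => ?_⟩
  exact hmax T' (fun t => (x' t, μ' t, w' t)) (isSolution_iff.1 hsol) fun t ht =>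
    Prod.ext (hx ht) (Prod.ext (hμ ht) (hw ht))

end

end VirtualTracking

open VirtualTracking in
theorem proposition1 {p n m : ℕ} [NeZero n] [NeZero m] (hmn : m ≤ n)
    (S : StrictFeedback p n)
    (hf₀ : ContDiff ℝ 1 S.f₀) (hg₀ : ContDiff ℝ 1 S.g₀)
    (hf : ∀ i, ContDiff ℝ 1 (Function.uncurry (S.f i)))
    (hg : ∀ i, ContDiff ℝ 1 (Function.uncurry (S.g i)))
    (L : Law n)
    (hsign : ∀ i x y, SignType.sign (S.g i x y) = L.s i)
    (hbound : ∀ i, ∃ b : ℝ, 0 < b ∧ ∀ x y, b ≤ |S.g i x y|)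
    (hk : ∀ i, 0 < L.k i)
    (hρpos : ∀ i, ∀ t : ℝ, 0 ≤ t → 0 < L.ρ i t)
    (hρsmooth : ContDiffOn ℝ n (L.ρ 0) (Set.Ici 0))
    (hρbdd : ∀ j ≤ n, ∃ B : ℝ, ∀ t : ℝ, 0 ≤ t →
      |iteratedDerivWithin j (L.ρ 0) (Set.Ici 0) t| ≤ B)
    (hρismooth : ∀ i, i ≠ 0 → ContDiffOn ℝ 1 (L.ρ i) (Set.Ici 0))
    (hρilim : ∀ i, i ≠ 0 → ∃ l : ℝ, 0 < l ∧ Filter.Tendsto (L.ρ i) Filter.atTop (nhds l))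
    (x₀ : XSpace p) (z₀ : Fin n → ℝ)
    (hinit : ∀ i, i ≠ 0 → |z₀ i - L.eta 0 (z₀ 0) z₀ i.castSucc| < L.ρ i 0) :
    (∀ (ν : ℝ → ℝ) (T : EReal) (x : ℝ → XSpace p) (μ : ℝ → Fin m → ℝ) (w : ℝ → Fin n → ℝ),
      IsSolution S L x₀ z₀ ν T x μ w → ReferenceBounded ν T μ →
      ∀ t ∈ timeDomain T,
        |w t 0| ≤ L.ρ 0 t ∧ ∀ i, |L.xi t (μ t 0) (fullState (μ t 0) (w t)) i| < 1) ∧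
    (∀ N : ℝ → XSpace p × (Fin m → ℝ) → ℝ, IsRegularFeedback N →
      (∃ (T : EReal) (x : ℝ → XSpace p) (μ : ℝ → Fin m → ℝ) (w : ℝ → Fin n → ℝ),
        IsMaximalSolution S L x₀ z₀ N T x μ w) ∧
      (∀ (T : EReal) (x : ℝ → XSpace p) (μ : ℝ → Fin m → ℝ) (w : ℝ → Fin n → ℝ),
        IsMaximalSolution S L x₀ z₀ N T x μ w →
        ReferenceBounded (fun t => N t (x t, μ t)) T μ → T ≠ ⊤ →
        ¬ Bornology.IsBounded ((fun t => (x t, μ t)) '' timeDomain T))) := by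
  have hρ : ∀ i, ContDiffOn ℝ 1 (L.ρ i) (Set.Ici 0) := fun i => by
    by_cases hi : i = 0
    · subst hi
      exact hρsmooth.of_le (by exact_mod_cast Nat.one_le_iff_ne_zero.2 (NeZero.ne n))
    · exact hρismooth i hi
  have hS : ContDiff ℝ 1 (S.plant (m := m)) := StrictFeedback.contDiff_plant hf₀ hg₀ hf hg
  have hfc := fun i => (hf i).continuous
  have hgc := fun i => (hg i).continuous
  refine ⟨fun ν T x μ w hsol hB t ht => ?_, fun N hN => ⟨?_, ?_⟩⟩
  · obtain ⟨-, hy0, hy⟩ := (isSolution_iff (N := fun t _ => ν t)).1 hsol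
    obtain ⟨B, hB⟩ := hB
    have hξ := hy.abs_xi_lt_one hfc hgc hsign hbound hk hρpos hρ hinit hy0
      ⟨B, fun s hs => (hB s hs).2⟩ ht
    refine ⟨?_, hξ⟩
    have hpos := hρpos 0 t ht.1
    have h0 := hξ 0
    have he : L.xi t (μ t 0) (fullState (μ t 0) (w t)) 0 = w t 0 / L.ρ 0 t := by
      simp [Law.xi, Law.eta_zero, fullState]
    change |L.xi t (μ t 0) (fullState (μ t 0) (w t)) 0| < 1 at h0
    rw [he, abs_div, abs_of_pos hpos, div_lt_one hpos] at h0
    exact h0.le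
  · exact exists_isMaximalSolution hS (fun i => hρpos i 0 le_rfl) (fun i => (hρ i).continuousOn)
      hinit hN
  · intro T x μ w ⟨hsol, hmax⟩ ⟨B, hB⟩ hT hbdd
    obtain ⟨hT0, hy0, hy⟩ := isSolution_iff.1 hsol
    have hξ := fun t ht i => hy.abs_xi_lt_one (t := t) hfc hgc hsign hbound hk hρpos hρ hinit hy0
      ⟨B, fun s hs => (hB s hs).2⟩ ht i
    lift T to ℝ using ⟨hT, (bot_le.trans_lt hT0).ne'⟩
    have hτ : 0 < T := by exact_mod_cast hT0
    obtain ⟨C, hC⟩ := hbdd.exists_norm_le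
    rw [timeDomain_coe] at hy hξ hC hmax
    obtain ⟨ε, hε, y', heq, hy'⟩ := hy.exists_extension_of_boundedOn hS hfc hgc hsign hbound hk
      hρpos hρ hN hτ ⟨C, fun t ht => hC _ (Set.mem_image_of_mem _ ht)⟩ hξ
    have hle : ((T + ε : ℝ) : EReal) ≤ T := hmax (T + ε : ℝ) (fun t => (y' t).1)
      (fun t => (y' t).2.1) (fun t => (y' t).2.2)
      (isSolution_iff.2 ⟨by exact_mod_cast add_pos hτ hε,
        (heq ⟨le_rfl, hτ⟩).trans hy0, by rwa [timeDomain_coe]⟩)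
      (fun t ht => congrArg Prod.fst (heq ht)) (fun t ht => congrArg (fun v => v.2.1) (heq ht))
      (fun t ht => congrArg (fun v => v.2.2) (heq ht))
    have : T + ε ≤ T := by exact_mod_cast hle
    linarith
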